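/- Let $G$ be a Lie group and $K\le H\le G$ closed subgroups such that $G/K$ is compact and connected; give $G/K$ and $G/H$ their smooth structures as homogeneous spaces and let $\pi\colon G/K\to G/H$, $aK\mapsto aH$, with fibre $\pi^{-1}(eH)=H/K$. Suppose that every $G$-invariant Riemannian metric on $G/K$ is a submersion metric for $H/K\to G/K\to G/H$, i.e. for every such metric $g$ there is a Riemannian metric on $G/H$ for which $\pi$ is a Riemannian submersion. Let $(g_i)_i$ be a family of $G$-invariant Riemannian metrics on $G/K$ (a sequence with $i\to\infty$, a one-parameter family with $i=t\to T$, or more generally a family indexed by a set with a filter along which limits are taken), and suppose that the fibre shrinks to a point: $H/K\subseteq G/K$ with the restriction of the Riemannian distance $d_{g_i}$ converges to a one-point space in the Gromov–Hausdorff sense, i.e. its diameter tends to $0$. Then there are $G$-invariant Riemannian metrics $b_i$ on $G/H$ for which $\pi\colon(G/K,g_i)\to(G/H,b_i)$ is a Riemannian submersion, such that $G/K$ converges to $G/H$ in the Gromov–Hausdorff sense: $$d_{GH}\big((G/K,d_{g_i}),(G/H,d_{b_i})\big)\to 0,$$ and, whenever the metrics $b_i$ converge pointwise to a Riemannian metric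 $b$ on $G/H$ (for example if all $b_i$ are equal to $b$), $$d_{GH}\big((G/K,d_{g_i}),(G/H,d_{b})\big)\to 0.$$ Here $d_{GH}(A,B)$ is the infimum of all $\epsilon$ for which there is a set $S\subseteq A\times B$ that projects onto $A$ and onto $B$ and satisfies $|d_A(p_1,q_1)-d_B(p_2,q_2)|<\epsilon$ for all $(p_1,p_2),(q_1,q_2)\in S$ (and $\infty$ if there is no such $\epsilon$). -/

import Mathlib

open Bundle Filter Topology
open scoped Manifold ContDiff ENNReal

noncomputable section

/-! ### The distance between metric spaces, in terms of their distance functions -/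

/-- `S ⊆ A × B` is an `ε`-approximation between `(A, dA)` and `(B, dB)`: it projects onto `A` and
onto `B`, and distances of corresponding points differ by less than `ε`. -/
structure IsApproximation {A B : Type*} (dA : A → A → ℝ) (dB : B → B → ℝ) (ε : ℝ)
    (S : Set (A × B)) : Prop where
  fst_onto : ∀ a, ∃ b, (a, b) ∈ S
  snd_onto : ∀ b, ∃ a, (a, b) ∈ S
  dist_lt : ∀ p ∈ S, ∀ q ∈ S, |dA p.1 q.1 - dB p.2 q.2| < ε

/-- The Gromov–Hausdorff distance: the infimum of all `ε` for which there is an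
`ε`-approximation, and `∞` if there is none. -/
def gromovHausdorffDist {A B : Type*} (dA : A → A → ℝ) (dB : B → B → ℝ) : ℝ≥0∞ :=
  ⨅ (ε : ℝ) (_ : ∃ S : Set (A × B), IsApproximation dA dB ε S), ENNReal.ofReal ε

/-! ### Riemannian metrics and Riemannian submersions -/

/-- Smooth Riemannian metrics on a manifold `M` modelled on `E`. -/
abbrev RiemMetric (E : Type*) [NormedAddCommGroup E] [NormedSpace ℝ E]
    (M : Type*) [TopologicalSpace M] [ChartedSpace E M] [IsManifold 𝓘(ℝ, E) ∞ M] :=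
  ContMDiffRiemannianMetric 𝓘(ℝ, E) ∞ E (fun x : M ↦ TangentSpace 𝓘(ℝ, E) x)

section Riemannian

variable {E : Type*} [NormedAddCommGroup E] [NormedSpace ℝ E]
  {M : Type*} [TopologicalSpace M] [ChartedSpace E M] [IsManifold 𝓘(ℝ, E) ∞ M]
  {F : Type*} [NormedAddCommGroup F] [NormedSpace ℝ F]
  {N : Type*} [TopologicalSpace N] [ChartedSpace F N] [IsManifold 𝓘(ℝ, F) ∞ N]

/-- The Riemannian distance of `g`: the infimum of the `g`-lengths of the `C¹` paths between two
points. It is used only on connected manifolds, where this infimum is finite. -/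
def RiemMetric.rdist (g : RiemMetric E M) (x y : M) : ℝ :=
  letI : RiemannianBundle (fun x : M ↦ TangentSpace 𝓘(ℝ, E) x) := ⟨g.toRiemannianMetric⟩
  (Manifold.riemannianEDist 𝓘(ℝ, E) x y).toReal

/-- `g` is invariant under the action of `G` on `M`: every `a : G` acts by isometries. -/
def RiemMetric.IsInvariant (G : Type*) [SMul G M] (g : RiemMetric E M) : Prop :=
  ∀ (a : G) (x : M) (v w : TangentSpace 𝓘(ℝ, E) x),
    g.inner (a • x)
      (mfderiv 𝓘(ℝ, E) 𝓘(ℝ, E) (fun y : M ↦ a • y) x v)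
      (mfderiv 𝓘(ℝ, E) 𝓘(ℝ, E) (fun y : M ↦ a • y) x w) = g.inner x v w

/-- `v` is horizontal for `f` at `x`: it is `g`-orthogonal to the vertical space `ker (df_x)`. -/
def RiemMetric.IsHorizontal (g : RiemMetric E M) (f : M → N) (x : M)
    (v : TangentSpace 𝓘(ℝ, E) x) : Prop :=
  ∀ u : TangentSpace 𝓘(ℝ, E) x, mfderiv 𝓘(ℝ, E) 𝓘(ℝ, F) f x u = 0 → g.inner x u v = 0

/-- `f : (M, g) → (N, h)` is a Riemannian submersion: a smooth submersion whose differential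
preserves inner products of horizontal vectors. -/
structure IsRiemannianSubmersion (g : RiemMetric E M) (h : RiemMetric F N) (f : M → N) :
    Prop where
  submersion : Manifold.IsSubmersion 𝓘(ℝ, E) 𝓘(ℝ, F) ∞ f
  isometry : ∀ (x : M) (v w : TangentSpace 𝓘(ℝ, E) x),
    g.IsHorizontal (F := F) f x v → g.IsHorizontal (F := F) f x w →
      h.inner (f x) (mfderiv 𝓘(ℝ, E) 𝓘(ℝ, F) f x v) (mfderiv 𝓘(ℝ, E) 𝓘(ℝ, F) f x w)
        = g.inner x v w

end Riemannian

/-! ### Homogeneous spaces -/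

/-- The manifold structure carried by `G ⧸ K` is the one of the homogeneous space, that is, the
(unique) smooth structure for which the quotient map `G → G ⧸ K` is a smooth submersion. -/
def IsHomogeneousManifold {E : Type*} [NormedAddCommGroup E] [NormedSpace ℝ E]
    {G : Type*} [TopologicalSpace G] [ChartedSpace E G] [Group G] (K : Subgroup G)
    (EK : Type*) [NormedAddCommGroup EK] [NormedSpace ℝ EK] [ChartedSpace EK (G ⧸ K)] : Prop :=
  Manifold.IsSubmersion 𝓘(ℝ, E) 𝓘(ℝ, EK) ∞ (QuotientGroup.mk : G → G ⧸ K)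

/-- The projection `G ⧸ K → G ⧸ H`, `aK ↦ aH`. -/
abbrev cosetProj {G : Type*} [Group G] {K H : Subgroup G} (hKH : K ≤ H) : G ⧸ K → G ⧸ H :=
  Subgroup.quotientMapOfLE hKH

/-- The fibre `H/K` of `G ⧸ K → G ⧸ H` over the base point `eH`, as a subset of `G ⧸ K`. -/
def cosetFibre {G : Type*} [Group G] {K H : Subgroup G} (hKH : K ≤ H) : Set (G ⧸ K) :=
  {x | cosetProj hKH x = ((1 : G) : G ⧸ H)}

end

/-! The projection π distorts distances by at most the diameter of the fibre `H/K`, so its graph is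
the required approximation. A Riemannian submersion does not lengthen vectors, hence base distances
are at most the distances above. Conversely, a curve from π(p) to π(q) can be followed upstairs from
p, at arbitrarily small extra length, to some q' in the fibre of q
(`IsRiemannianSubmersion.exists_edist_le`). The points q' and q share a fibre, and G acts
transitively by isometries, so that fibre is an isometric translate of `H/K` and d(q', q) is at most
its diameter. This gives `abs_rdist_sub_rdist_cosetProj_le`.

The base metrics are invariant because π is equivariant and horizontal lifts determine them. If they
converge pointwise, then at one point the inner products converge uniformly on the unit sphere.
Transitivity spreads the resulting factor 1 + η over `G ⧸ H`, and the finite diameter of the limit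
turns it into a uniform additive error (`RiemMetric.eventually_abs_rdist_sub_le`). -/

open MeasureTheory Set

/-! ### Riemannian distance and length of curves -/

section Length

variable {E : Type*} [NormedAddCommGroup E] [NormedSpace ℝ E]
  {M : Type*} [TopologicalSpace M] [ChartedSpace E M] [IsManifold 𝓘(ℝ, E) ∞ M]
  {F : Type*} [NormedAddCommGroup F] [NormedSpace ℝ F]
  {N : Type*} [TopologicalSpace N] [ChartedSpace F N] [IsManifold 𝓘(ℝ, F) ∞ N]

namespace RiemMetric

/-- The Riemannian distance of `g`, with values in `[0, ∞]`. -/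
noncomputable def edist (g : RiemMetric E M) (x y : M) : ℝ≥0∞ :=
  letI : RiemannianBundle (fun x : M ↦ TangentSpace 𝓘(ℝ, E) x) := ⟨g.toRiemannianMetric⟩
  Manifold.riemannianEDist 𝓘(ℝ, E) x y

/-- The speed of a curve with respect to `g`. -/
noncomputable def speed (g : RiemMetric E M) (γ : ℝ → M) (t : ℝ) : ℝ :=
  √(g.inner (γ t) (mfderiv 𝓘(ℝ, ℝ) 𝓘(ℝ, E) γ t (1 : ℝ)) (mfderiv 𝓘(ℝ, ℝ) 𝓘(ℝ, E) γ t (1 : ℝ)))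

variable (g : RiemMetric E M)

lemma rdist_eq_toReal_edist (x y : M) : g.rdist x y = (g.edist x y).toReal := rfl

lemma inner_self_nonneg (x : M) (v : TangentSpace 𝓘(ℝ, E) x) : 0 ≤ g.inner x v v := by
  rcases eq_or_ne v 0 with rfl | hv
  · simp
  · exact (g.pos x v hv).le

lemma edist_self (x : M) : g.edist x x = 0 :=
  let : RiemannianBundle (fun x : M ↦ TangentSpace 𝓘(ℝ, E) x) := ⟨g.toRiemannianMetric⟩
  Manifold.riemannianEDist_self

lemma edist_comm (x y : M) : g.edist x y = g.edist y x :=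
  let : RiemannianBundle (fun x : M ↦ TangentSpace 𝓘(ℝ, E) x) := ⟨g.toRiemannianMetric⟩
  Manifold.riemannianEDist_comm

lemma edist_triangle (x y z : M) : g.edist x z ≤ g.edist x y + g.edist y z :=
  let : RiemannianBundle (fun x : M ↦ TangentSpace 𝓘(ℝ, E) x) := ⟨g.toRiemannianMetric⟩
  Manifold.riemannianEDist_triangle

lemma eventually_edist_lt (x : M) {c : ℝ≥0∞} (hc : 0 < c) : ∀ᶠ y in 𝓝 x, g.edist x y < c := by
  let : RiemannianBundle (fun x : M ↦ TangentSpace 𝓘(ℝ, E) x) := ⟨g.toRiemannianMetric⟩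
  have : IsContinuousRiemannianBundle E (fun x : M ↦ TangentSpace 𝓘(ℝ, E) x) :=
    ⟨g.inner, g.contMDiff.continuous, fun _ _ _ ↦ rfl⟩
  exact eventually_riemannianEDist_lt 𝓘(ℝ, E) x hc

lemma edist_le_lintegral_speed {γ : ℝ → M} {a b : ℝ} (hab : a ≤ b)
    (hγ : ContMDiffOn 𝓘(ℝ, ℝ) 𝓘(ℝ, E) 1 γ (Icc a b)) :
    g.edist (γ a) (γ b) ≤ ∫⁻ t in Icc a b, ENNReal.ofReal (g.speed γ t) := by
  let : RiemannianBundle (fun x : M ↦ TangentSpace 𝓘(ℝ, E) x) := ⟨g.toRiemannianMetric⟩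
  have := Manifold.riemannianEDist_le_pathELength hγ rfl rfl hab
  rw [Manifold.pathELength_eq_lintegral_mfderiv_Icc] at this
  refine this.trans_eq (lintegral_congr fun t ↦ ?_)
  rw [← ofReal_norm, norm_eq_sqrt_real_inner]
  rfl

lemma exists_curve_of_edist_lt {x y : M} {r : ℝ≥0∞} (h : g.edist x y < r) :
    ∃ γ : ℝ → M, γ 0 = x ∧ γ 1 = y ∧ ContMDiff 𝓘(ℝ, ℝ) 𝓘(ℝ, E) 1 γ ∧
      ∫⁻ t in Icc 0 1, ENNReal.ofReal (g.speed γ t) < r := by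
  let : RiemannianBundle (fun x : M ↦ TangentSpace 𝓘(ℝ, E) x) := ⟨g.toRiemannianMetric⟩
  obtain ⟨γ, h0, h1, hγ, hl, -⟩ :=
    Manifold.exists_lt_locally_constant_of_riemannianEDist_lt h zero_lt_one
  refine ⟨γ, h0, h1, hγ, ?_⟩
  rw [Manifold.pathELength_eq_lintegral_mfderiv_Icc] at hl
  refine (lintegral_congr fun t ↦ ?_).trans_lt hl
  rw [← ofReal_norm, norm_eq_sqrt_real_inner]
  rfl

lemma continuousOn_speed {γ : ℝ → M} {U : Set ℝ} (hU : IsOpen U)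
    (hγ : ContMDiffOn 𝓘(ℝ, ℝ) 𝓘(ℝ, E) 1 γ U) : ContinuousOn (g.speed γ) U := by
  let : RiemannianBundle (fun x : M ↦ TangentSpace 𝓘(ℝ, E) x) := ⟨g.toRiemannianMetric⟩
  have : IsContinuousRiemannianBundle E (fun x : M ↦ TangentSpace 𝓘(ℝ, E) x) :=
    ⟨g.inner, g.contMDiff.continuous, fun _ _ _ ↦ rfl⟩
  have h1 := hγ.continuousOn_tangentMapWithin le_rfl hU.uniqueMDiffOn
  have h2 : ContinuousOn (fun t : ℝ ↦ tangentMapWithin 𝓘(ℝ, ℝ) 𝓘(ℝ, E) γ U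
      ((tangentBundleModelSpaceHomeomorph 𝓘(ℝ, ℝ)).symm (t, (1 : ℝ)))) U := by
    refine h1.comp (Continuous.continuousOn (by fun_prop)) fun t ht ↦ ?_
    exact ht
  have h3 : ContinuousOn (fun t : ℝ ↦ (⟨γ t, mfderiv 𝓘(ℝ, ℝ) 𝓘(ℝ, E) γ t (1 : ℝ)⟩ :
      TotalSpace E (fun x : M ↦ TangentSpace 𝓘(ℝ, E) x))) U := by
    refine h2.congr fun t ht ↦ ?_
    simp only [tangentMapWithin]
    rw [← mfderivWithin_of_isOpen hU ht]
    rfl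
  have h4 := h3.inner_bundle h3
  exact h4.sqrt

lemma continuous_speed {γ : ℝ → M} (hγ : ContMDiff 𝓘(ℝ, ℝ) 𝓘(ℝ, E) 1 γ) :
    Continuous (g.speed γ) :=
  continuousOn_univ.1 (g.continuousOn_speed isOpen_univ hγ.contMDiffOn)

lemma isOpen_setOf_edist_lt (x : M) (c : ℝ≥0∞) : IsOpen {y | g.edist x y < c} := by
  refine isOpen_iff_mem_nhds.2 fun y hy ↦ ?_
  filter_upwards [g.eventually_edist_lt y (tsub_pos_of_lt hy)] with z hz
  calc g.edist x z ≤ g.edist x y + g.edist y z := g.edist_triangle x y z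
    _ < g.edist x y + (c - g.edist x y) := ENNReal.add_lt_add_left (ne_top_of_lt hy) hz
    _ = c := add_tsub_cancel_of_le (le_of_lt hy)

lemma isClosed_setOf_edist_le (x : M) (c : ℝ≥0∞) : IsClosed {y | g.edist x y ≤ c} := by
  rw [← isOpen_compl_iff]
  refine isOpen_iff_mem_nhds.2 fun y hy ↦ ?_
  have hy : c < g.edist x y := not_le.1 hy
  filter_upwards [g.eventually_edist_lt y (tsub_pos_of_lt hy)] with z hz
  simp only [mem_compl_iff, mem_ofPred_eq, not_le]
  by_contra! hc
  have := (g.edist_triangle x z y).trans (add_le_add_left hc _)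
  rw [g.edist_comm z y] at this
  have h2 : g.edist x y - c ≤ g.edist y z := by
    rw [tsub_le_iff_left]; exact this
  exact absurd hz (not_lt.2 h2)

lemma continuous_edist (x : M) : Continuous (g.edist x) := by
  refine continuous_iff_continuousAt.2 fun y ↦ tendsto_order.2 ⟨fun c hc ↦ ?_, fun c hc ↦ ?_⟩
  · have := (g.isClosed_setOf_edist_le x c).isOpen_compl.mem_nhds (x := y) (by simpa using hc)
    filter_upwards [this] with z hz using not_le.1 hz
  · exact (g.isOpen_setOf_edist_lt x c).mem_nhds hc

/-- By the triangle inequality, finite and infinite distance from `x` are both open conditions on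
the other point; connectedness leaves only the one satisfied by `x`. -/
lemma edist_ne_top [PreconnectedSpace M] (x y : M) : g.edist x y ≠ ⊤ := by
  have hcl : IsClopen {y | g.edist x y < ⊤} := by
    refine ⟨?_, g.isOpen_setOf_edist_lt x ∞⟩
    rw [← isOpen_compl_iff]
    refine isOpen_iff_mem_nhds.2 fun y hy ↦ ?_
    filter_upwards [g.eventually_edist_lt y ENNReal.zero_lt_top] with z hz
    simp only [mem_compl_iff, mem_ofPred_eq, not_lt, top_le_iff] at hy ⊢
    by_contra hc
    have := g.edist_triangle x z y
    rw [hy, g.edist_comm z y, top_le_iff, ENNReal.add_eq_top] at this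
    exact this.elim hc hz.ne
  have := hcl.eq_univ ⟨x, by simp [g.edist_self]⟩
  have h : y ∈ {y | g.edist x y < ⊤} := this ▸ mem_univ y
  exact ne_of_lt h

/-- A `C¹` map whose differential stretches by at most `C` stretches distances by at most `C`. -/
lemma edist_map_le (g : RiemMetric E M) (h : RiemMetric F N) {f : M → N}
    (hf : ContMDiff 𝓘(ℝ, E) 𝓘(ℝ, F) 1 f) {C : ℝ} (hC : 0 < C)
    (hfC : ∀ (x : M) (v : TangentSpace 𝓘(ℝ, E) x),
      h.inner (f x) (mfderiv 𝓘(ℝ, E) 𝓘(ℝ, F) f x v) (mfderiv 𝓘(ℝ, E) 𝓘(ℝ, F) f x v)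
        ≤ C ^ 2 * g.inner x v v) (x y : M) :
    h.edist (f x) (f y) ≤ ENNReal.ofReal C * g.edist x y := by
  have key : ∀ r, g.edist x y < r → h.edist (f x) (f y) ≤ ENNReal.ofReal C * r := by
    intro r hr
    obtain ⟨γ, rfl, rfl, hγ, hl⟩ := g.exists_curve_of_edist_lt hr
    calc h.edist (f (γ 0)) (f (γ 1))
        ≤ ∫⁻ t in Icc 0 1, ENNReal.ofReal (h.speed (f ∘ γ) t) :=
          h.edist_le_lintegral_speed zero_le_one (hf.comp hγ).contMDiffOn
      _ ≤ ∫⁻ t in Icc 0 1, ENNReal.ofReal C * ENNReal.ofReal (g.speed γ t) := by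
          refine lintegral_mono fun t ↦ ?_
          rw [← ENNReal.ofReal_mul hC.le]
          refine ENNReal.ofReal_le_ofReal ?_
          have hd : mfderiv 𝓘(ℝ, ℝ) 𝓘(ℝ, F) (f ∘ γ) t (1 : ℝ) =
              mfderiv 𝓘(ℝ, E) 𝓘(ℝ, F) f (γ t) (mfderiv 𝓘(ℝ, ℝ) 𝓘(ℝ, E) γ t (1 : ℝ)) := by
            rw [mfderiv_comp t (hf.mdifferentiable one_ne_zero _)
              (hγ.mdifferentiable one_ne_zero _)]
            rfl
          rw [speed, speed, hd, ← Real.sqrt_sq hC.le, ← Real.sqrt_mul (sq_nonneg C)]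
          exact Real.sqrt_le_sqrt (hfC _ _)
      _ = ENNReal.ofReal C * ∫⁻ t in Icc 0 1, ENNReal.ofReal (g.speed γ t) :=
          lintegral_const_mul' _ _ ENNReal.ofReal_ne_top
      _ ≤ ENNReal.ofReal C * r := by gcongr
  have hC' : ENNReal.ofReal C ≠ 0 := by simpa using hC
  rw [mul_comm, ← ENNReal.div_le_iff hC' ENNReal.ofReal_ne_top]
  refine le_of_forall_gt_imp_ge_of_dense fun r hr ↦ ?_
  rw [ENNReal.div_le_iff hC' ENNReal.ofReal_ne_top, mul_comm]
  exact key r hr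

end RiemMetric

end Length

/-! ### Local lifts through submersions -/

section Submersion

open Manifold

variable {E : Type*} [NormedAddCommGroup E] [NormedSpace ℝ E]
  {M : Type*} [TopologicalSpace M] [ChartedSpace E M]
  {F : Type*} [NormedAddCommGroup F] [NormedSpace ℝ F]
  {N : Type*} [TopologicalSpace N] [ChartedSpace F N]
  {P' : Type*} [NormedAddCommGroup P'] [NormedSpace ℝ P']
  {P : Type*} [TopologicalSpace P] [ChartedSpace P' P]
  {C : Type*} [NormedAddCommGroup C] [NormedSpace ℝ C] {f : M → N} {x : M}

namespace Manifold.IsSubmersionAtOfComplement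

lemma codChart_apply (h : IsSubmersionAtOfComplement C 𝓘(ℝ, E) 𝓘(ℝ, F) ∞ f x) {p : M}
    (hp : p ∈ h.domChart.source) : h.codChart (f p) = (h.equiv (h.domChart p)).1 := by
  have hp' : h.domChart p ∈ (h.domChart.extend 𝓘(ℝ, E)).target := by
    simpa using h.domChart.map_source hp
  have := h.writtenInCharts hp'
  simpa [h.domChart.left_inv hp] using this

/-- A map into the base of a submersion lifts locally, with a prescribed component along the
fibres. -/
lemma exists_lift (h : IsSubmersionAtOfComplement C 𝓘(ℝ, E) 𝓘(ℝ, F) ∞ f x) {n : ℕ∞ω} (hn : n ≤ (∞ : ℕ∞ω))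
    {η : P → N} {ζ : P → C} {p : P} (hη : ContMDiffAt 𝓘(ℝ, P') 𝓘(ℝ, F) n η p)
    (hζ : ContMDiffAt 𝓘(ℝ, P') 𝓘(ℝ, C) n ζ p) (hηp : η p = f x)
    (hζp : ζ p = (h.equiv (h.domChart x)).2) :
    ∃ c : P → M, c p = x ∧ ContMDiffAt 𝓘(ℝ, P') 𝓘(ℝ, E) n c p ∧ (∀ᶠ q in 𝓝 p, f (c q) = η q) ∧
      ∀ᶠ q in 𝓝 p, (h.equiv (h.domChart (c q))).2 = ζ q := by
  have hψ : ContMDiffAt 𝓘(ℝ, P') 𝓘(ℝ, F) n (fun q ↦ h.codChart (η q)) p := by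
    refine ContMDiffAt.comp p (I' := 𝓘(ℝ, F)) ?_ hη
    exact (contMDiffAt_of_mem_maximalAtlas h.codChart_mem_maximalAtlas
      (hηp ▸ h.mem_codChart_source)).of_le hn
  -- In the charts the submersion is the projection `F × C → F`, so a lift is the base map paired
  -- with the prescribed fibre component.
  let k : P → E := fun q ↦ h.equiv.symm (h.codChart (η q), ζ q)
  have hk : ContMDiffAt 𝓘(ℝ, P') 𝓘(ℝ, E) n k p :=
    h.equiv.symm.contDiff.contMDiff.contMDiffAt.comp p (hψ.prodMk_space hζ)
  have hkp : k p = h.domChart x := by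
    simp only [k]
    rw [hηp, hζp, h.codChart_apply h.mem_domChart_source]
    simp
  have hkt : ∀ᶠ q in 𝓝 p, k q ∈ h.domChart.target := by
    refine hk.continuousAt.eventually_mem (h.domChart.open_target.mem_nhds ?_)
    rw [hkp]
    exact h.domChart.map_source h.mem_domChart_source
  have hηs : ∀ᶠ q in 𝓝 p, η q ∈ h.codChart.source := by
    refine hη.continuousAt.eventually_mem (h.codChart.open_source.mem_nhds ?_)
    rw [hηp]
    exact h.mem_codChart_source
  refine ⟨fun q ↦ h.domChart.symm (k q), ?_, ?_, ?_, ?_⟩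
  · beta_reduce
    rw [hkp, h.domChart.left_inv h.mem_domChart_source]
  · refine ContMDiffAt.comp p (I' := 𝓘(ℝ, E)) ?_ hk
    exact (contMDiffAt_symm_of_mem_maximalAtlas h.domChart_mem_maximalAtlas hkt.self_of_nhds).of_le
      hn
  · filter_upwards [hkt, hηs] with q hq hq'
    have hs := h.domChart.map_target hq
    refine h.codChart.injOn (h.source_subset_preimage_source hs) hq' ?_
    rw [h.codChart_apply hs, h.domChart.right_inv hq]
    simp [k]
  · filter_upwards [hkt] with q hq
    rw [h.domChart.right_inv hq]
    simp [k]

lemma mdifferentiable_domChart (h : IsSubmersionAtOfComplement C 𝓘(ℝ, E) 𝓘(ℝ, F) ∞ f x) :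
    h.domChart.MDifferentiable 𝓘(ℝ, E) 𝓘(ℝ, E) :=
  ⟨(contMDiffOn_of_mem_maximalAtlas h.domChart_mem_maximalAtlas).mdifferentiableOn (by simp),
    (contMDiffOn_symm_of_mem_maximalAtlas h.domChart_mem_maximalAtlas).mdifferentiableOn (by simp)⟩

lemma mdifferentiable_codChart (h : IsSubmersionAtOfComplement C 𝓘(ℝ, E) 𝓘(ℝ, F) ∞ f x) :
    h.codChart.MDifferentiable 𝓘(ℝ, F) 𝓘(ℝ, F) :=
  ⟨(contMDiffOn_of_mem_maximalAtlas h.codChart_mem_maximalAtlas).mdifferentiableOn (by simp),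
    (contMDiffOn_symm_of_mem_maximalAtlas h.codChart_mem_maximalAtlas).mdifferentiableOn (by simp)⟩

lemma mfderiv_codChart_mfderiv (h : IsSubmersionAtOfComplement C 𝓘(ℝ, E) 𝓘(ℝ, F) ∞ f x)
    (v : TangentSpace 𝓘(ℝ, E) x) :
    mfderiv 𝓘(ℝ, F) 𝓘(ℝ, F) h.codChart (f x) (mfderiv 𝓘(ℝ, E) 𝓘(ℝ, F) f x v) =
      (h.equiv (mfderiv 𝓘(ℝ, E) 𝓘(ℝ, E) h.domChart x v)).1 := by
  let L : E →L[ℝ] F := (ContinuousLinearMap.fst ℝ F C).comp (h.equiv : E →L[ℝ] F × C)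
  have h1 : (h.codChart ∘ f) =ᶠ[𝓝 x] (L ∘ h.domChart) := by
    filter_upwards [h.domChart.open_source.mem_nhds h.mem_domChart_source] with p hp
    exact h.codChart_apply hp
  have h2 := h1.mfderiv_eq (I := 𝓘(ℝ, E)) (I' := 𝓘(ℝ, F))
  rw [mfderiv_comp x (h.mdifferentiable_codChart.mdifferentiableAt h.mem_codChart_source)
      (h.contMDiffAt.mdifferentiableAt (by simp)),
    mfderiv_comp x L.mdifferentiableAt
      (h.mdifferentiable_domChart.mdifferentiableAt h.mem_domChart_source)] at h2
  have h3 := DFunLike.congr_fun h2 v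
  rw [L.mfderiv_eq] at h3
  exact h3

lemma mfderiv_surjective (h : IsSubmersionAtOfComplement C 𝓘(ℝ, E) 𝓘(ℝ, F) ∞ f x) :
    Function.Surjective (mfderiv 𝓘(ℝ, E) 𝓘(ℝ, F) f x) := by
  intro v
  obtain ⟨u, hu⟩ := h.mdifferentiable_domChart.mfderiv_surjective h.mem_domChart_source
    (h.equiv.symm (mfderiv 𝓘(ℝ, F) 𝓘(ℝ, F) h.codChart (f x) v, 0))
  refine ⟨u, h.mdifferentiable_codChart.mfderiv_injective h.mem_codChart_source ?_⟩
  rw [h.mfderiv_codChart_mfderiv, hu]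
  exact congrArg Prod.fst (h.equiv.apply_symm_apply _)

/-- Through every point, a submersion has a local section. -/
lemma exists_section (h : IsSubmersionAtOfComplement C 𝓘(ℝ, E) 𝓘(ℝ, F) ∞ f x) :
    ∃ s : N → M, s (f x) = x ∧ ContMDiffAt 𝓘(ℝ, F) 𝓘(ℝ, E) ∞ s (f x) ∧
      ∀ᶠ y in 𝓝 (f x), f (s y) = y := by
  obtain ⟨s, h1, h2, h3, -⟩ := h.exists_lift (η := id) (ζ := fun _ ↦ (h.equiv (h.domChart x)).2)
    le_rfl contMDiffAt_id contMDiffAt_const rfl rfl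
  exact ⟨s, h1, h2, h3⟩

/-- A curve in the base of a submersion lifts locally, with a prescribed velocity. -/
lemma exists_curve_lift (h : IsSubmersionAtOfComplement C 𝓘(ℝ, E) 𝓘(ℝ, F) ∞ f x) {γ : ℝ → N}
    {t : ℝ} (hγ : ContMDiffAt 𝓘(ℝ, ℝ) 𝓘(ℝ, F) 1 γ t) (hγt : f x = γ t)
    (u : TangentSpace 𝓘(ℝ, E) x)
    (hu : (mfderiv 𝓘(ℝ, E) 𝓘(ℝ, F) f x u : F) = mfderiv 𝓘(ℝ, ℝ) 𝓘(ℝ, F) γ t (1 : ℝ)) :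
    ∃ c : ℝ → M, c t = x ∧ ContMDiffAt 𝓘(ℝ, ℝ) 𝓘(ℝ, E) 1 c t ∧ (∀ᶠ s in 𝓝 t, f (c s) = γ s) ∧
      (mfderiv 𝓘(ℝ, ℝ) 𝓘(ℝ, E) c t (1 : ℝ) : E) = u := by
  let w : C := (h.equiv (mfderiv 𝓘(ℝ, E) 𝓘(ℝ, E) h.domChart x u)).2
  -- The fibre component moves on a line with the fibre velocity of `u`; the base part of the
  -- velocity is forced by `f ∘ c = γ` and agrees by `hu`.
  let ζ : ℝ → C := fun s ↦ (h.equiv (h.domChart x)).2 + (s - t) • w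
  have hζ : HasDerivAt ζ w t := by
    have := (((hasDerivAt_id t).sub_const t).smul_const w).const_add (h.equiv (h.domChart x)).2
    rwa [one_smul] at this
  have hζc : ContDiff ℝ 1 ζ := by fun_prop
  obtain ⟨c, hc0, hc, hfc, hζc'⟩ := h.exists_lift (n := 1) (η := γ) (ζ := ζ) (by simp) hγ
    hζc.contMDiff.contMDiffAt hγt.symm (by simp [ζ])
  refine ⟨c, hc0, hc, hfc, ?_⟩
  subst hc0
  have hdc := hc.mdifferentiableAt one_ne_zero
  refine h.mdifferentiable_domChart.mfderiv_injective h.mem_domChart_source ?_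
  refine h.equiv.injective (Prod.ext ?_ ?_)
  · have h1 := (show f ∘ c =ᶠ[𝓝 t] γ from hfc).mfderiv_eq (I := 𝓘(ℝ, ℝ)) (I' := 𝓘(ℝ, F))
    rw [mfderiv_comp t (h.contMDiffAt.mdifferentiableAt (by simp)) hdc] at h1
    have h2 := DFunLike.congr_fun h1 (1 : ℝ)
    have h3 := h.mfderiv_codChart_mfderiv (mfderiv 𝓘(ℝ, ℝ) 𝓘(ℝ, E) c t (1 : ℝ))
    have h4 := h.mfderiv_codChart_mfderiv u
    refine h3.symm.trans (Eq.trans ?_ h4)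
    refine congrArg (mfderiv 𝓘(ℝ, F) 𝓘(ℝ, F) h.codChart (f (c t))) ?_
    exact Eq.trans h2 hu.symm
  · let L : E →L[ℝ] C := (ContinuousLinearMap.snd ℝ F C).comp (h.equiv : E →L[ℝ] F × C)
    have h1 := (show L ∘ (h.domChart ∘ c) =ᶠ[𝓝 t] ζ from hζc').mfderiv_eq
      (I := 𝓘(ℝ, ℝ)) (I' := 𝓘(ℝ, C))
    have hd := h.mdifferentiable_domChart.mdifferentiableAt h.mem_domChart_source
    rw [mfderiv_comp t L.mdifferentiableAt (hd.comp t hdc), mfderiv_comp t hd hdc,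
      L.mfderiv_eq, mfderiv_eq_fderiv] at h1
    have h2 := DFunLike.congr_fun h1 (1 : ℝ)
    have h3 : fderiv ℝ ζ t (1 : ℝ) = w := by rw [hζ.hasFDerivAt.fderiv]; simp
    exact Eq.trans h2 h3

end Manifold.IsSubmersionAtOfComplement

/-- A map on the base of a surjective submersion is smooth if its composition with the submersion
is smooth. -/
lemma Manifold.IsSubmersion.contMDiff_of_comp (hf : IsSubmersion 𝓘(ℝ, E) 𝓘(ℝ, F) ∞ f)
    (hs : Function.Surjective f) {k : N → P}
    (hk : ContMDiff 𝓘(ℝ, E) 𝓘(ℝ, P') ∞ (k ∘ f)) : ContMDiff 𝓘(ℝ, F) 𝓘(ℝ, P') ∞ k := by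
  intro y
  obtain ⟨x, rfl⟩ := hs y
  -- Near `f x`, `k` equals `(k ∘ f) ∘ s` for a smooth local section `s`.
  obtain ⟨s, -, h2, h3⟩ := (hf.isSubmersionOfComplement_complement x).exists_section
  refine (hk.contMDiffAt.comp (f x) h2).congr_of_eventuallyEq ?_
  filter_upwards [h3] with z hz
  simp [hz]

end Submersion

/-! ### Riemannian submersions and equidistant fibres -/

section RiemannianSubmersion

variable {E : Type*} [NormedAddCommGroup E] [NormedSpace ℝ E]
  {M : Type*} [TopologicalSpace M] [ChartedSpace E M] [IsManifold 𝓘(ℝ, E) ∞ M]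
  {F : Type*} [NormedAddCommGroup F] [NormedSpace ℝ F]
  {N : Type*} [TopologicalSpace N] [ChartedSpace F N]

lemma RiemMetric.exists_isHorizontal [FiniteDimensional ℝ E] (g : RiemMetric E M) (f : M → N)
    (x : M) (v : TangentSpace 𝓘(ℝ, E) x) :
    ∃ w : TangentSpace 𝓘(ℝ, E) x, g.IsHorizontal (F := F) f x w ∧
      mfderiv 𝓘(ℝ, E) 𝓘(ℝ, F) f x w = mfderiv 𝓘(ℝ, E) 𝓘(ℝ, F) f x v := by
  let : RiemannianBundle (fun x : M ↦ TangentSpace 𝓘(ℝ, E) x) := ⟨g.toRiemannianMetric⟩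
  have : FiniteDimensional ℝ (TangentSpace 𝓘(ℝ, E) x) := inferInstanceAs (FiniteDimensional ℝ E)
  let K : Submodule ℝ (TangentSpace 𝓘(ℝ, E) x) :=
    LinearMap.ker (mfderiv 𝓘(ℝ, E) 𝓘(ℝ, F) f x).toLinearMap
  have : CompleteSpace K := FiniteDimensional.complete ℝ K
  obtain ⟨y, hy, z, hz, hv⟩ := K.exists_add_mem_mem_orthogonal v
  refine ⟨z, fun u hu ↦ ?_, ?_⟩
  · exact (Submodule.mem_orthogonal K z).1 hz u (LinearMap.mem_ker.2 hu)
  · have hy' : mfderiv 𝓘(ℝ, E) 𝓘(ℝ, F) f x y = 0 := LinearMap.mem_ker.1 hy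
    rw [hv, map_add, hy', zero_add]

variable [IsManifold 𝓘(ℝ, F) ∞ N]

namespace IsRiemannianSubmersion

variable {g : RiemMetric E M} {b : RiemMetric F N} {f : M → N}

lemma contMDiff (h : IsRiemannianSubmersion g b f) : ContMDiff 𝓘(ℝ, E) 𝓘(ℝ, F) ∞ f :=
  h.submersion.contMDiff

lemma mfderiv_surjective (h : IsRiemannianSubmersion g b f) (x : M) :
    Function.Surjective (mfderiv 𝓘(ℝ, E) 𝓘(ℝ, F) f x) :=
  (h.submersion.isSubmersionOfComplement_complement x).mfderiv_surjective

lemma exists_isHorizontal_lift [FiniteDimensional ℝ E] (h : IsRiemannianSubmersion g b f) (x : M)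
    (v : TangentSpace 𝓘(ℝ, F) (f x)) :
    ∃ w : TangentSpace 𝓘(ℝ, E) x, g.IsHorizontal (F := F) f x w ∧
      mfderiv 𝓘(ℝ, E) 𝓘(ℝ, F) f x w = v := by
  obtain ⟨u, rfl⟩ := h.mfderiv_surjective x v
  exact g.exists_isHorizontal f x u

/-- Pythagoras: the vertical part of `v` is killed by the differential and only adds to the norm
upstairs. -/
lemma inner_mfderiv_le [FiniteDimensional ℝ E] (h : IsRiemannianSubmersion g b f) (x : M)
    (v : TangentSpace 𝓘(ℝ, E) x) :
    b.inner (f x) (mfderiv 𝓘(ℝ, E) 𝓘(ℝ, F) f x v) (mfderiv 𝓘(ℝ, E) 𝓘(ℝ, F) f x v) ≤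
      g.inner x v v := by
  obtain ⟨w, hw, hwv⟩ := g.exists_isHorizontal (F := F) f x v
  rw [← hwv, h.isometry x w w hw hw]
  obtain ⟨u, rfl⟩ : ∃ u, v = u + w := ⟨v - w, by simp⟩
  have hu : mfderiv 𝓘(ℝ, E) 𝓘(ℝ, F) f x u = 0 := by
    rw [map_add] at hwv
    exact left_eq_add.1 ((add_comm _ _).trans hwv.symm).symm
  have h1 := hw u hu
  have h2 := g.symm x w u
  have h3 := g.inner_self_nonneg x u
  simp only [map_add, add_apply]
  linarith

lemma edist_le [FiniteDimensional ℝ E] (h : IsRiemannianSubmersion g b f) (x y : M) :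
    b.edist (f x) (f y) ≤ g.edist x y := by
  simpa using RiemMetric.edist_map_le g b (h.contMDiff.of_le (by simp)) one_pos
    (by simpa using h.inner_mfderiv_le) x y

end IsRiemannianSubmersion

lemma lintegral_Icc_ofReal_eq_intervalIntegral {k : ℝ → ℝ} (hk : Continuous k) (hk0 : ∀ t, 0 ≤ k t)
    {a b : ℝ} (hab : a ≤ b) :
    ∫⁻ t in Icc a b, ENNReal.ofReal (k t) = ENNReal.ofReal (∫ t in a..b, k t) := by
  rw [intervalIntegral.integral_of_le hab, ← integral_Icc_eq_integral_Ioc,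
    ofReal_integral_eq_lintegral_ofReal hk.continuousOn.integrableOn_Icc (.of_forall hk0)]

/-- Curves in the base of a Riemannian submersion with compact total space lift to chains of points
which are not much longer, so that fibres are equidistant. -/
lemma IsRiemannianSubmersion.exists_edist_le [FiniteDimensional ℝ E] [CompactSpace M] [T2Space N]
    {g : RiemMetric E M} {b : RiemMetric F N} {f : M → N} (h : IsRiemannianSubmersion g b f)
    {x : M} {y : N} {r : ℝ≥0∞} (hr : b.edist (f x) y < r) :
    ∃ x', f x' = y ∧ g.edist x x' ≤ r := by
  obtain ⟨γ, h0, rfl, hγ, hl⟩ := b.exists_curve_of_edist_lt hr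
  obtain ⟨ε, hε, hlε⟩ : ∃ ε : ℝ, 0 < ε ∧
      (∫⁻ t in Icc 0 1, ENNReal.ofReal (b.speed γ t)) + ENNReal.ofReal ε < r := by
    obtain ⟨ε, hε, hlε⟩ := ENNReal.lt_iff_exists_add_pos_lt.1 hl
    exact ⟨ε, hε, by simpa using hlε⟩
  have hv : Continuous (b.speed γ) := b.continuous_speed hγ
  have hv0 : ∀ t, 0 ≤ b.speed γ t + ε := fun t ↦ add_nonneg (Real.sqrt_nonneg _) hε.le
  have hvc : Continuous fun t ↦ b.speed γ t + ε := by fun_prop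
  -- `Φ t` is the distance allowed up to time `t`; the surplus speed `ε` absorbs the error of the
  -- local lifts.
  let Φ : ℝ → ℝ≥0∞ := fun t ↦ ENNReal.ofReal (∫ s in (0 : ℝ)..t, (b.speed γ s + ε))
  have hΦ : Continuous Φ :=
    ENNReal.continuous_ofReal.comp (intervalIntegral.continuous_primitive
      (fun _ _ ↦ hvc.intervalIntegrable _ _) 0)
  have hΦadd : ∀ s t, 0 ≤ s → s ≤ t →
      Φ t = Φ s + ∫⁻ τ in Icc s t, ENNReal.ofReal (b.speed γ τ + ε) := by
    intro s t hs hst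
    rw [lintegral_Icc_ofReal_eq_intervalIntegral hvc hv0 hst,
      ← ENNReal.ofReal_add (intervalIntegral.integral_nonneg hs fun _ _ ↦ hv0 _)
        (intervalIntegral.integral_nonneg hst fun _ _ ↦ hv0 _),
      intervalIntegral.integral_add_adjacent_intervals (hvc.intervalIntegrable _ _)
        (hvc.intervalIntegrable _ _)]
  -- Continuous induction on the times whose fibre is reachable within the allowance; this avoids a
  -- global horizontal lift of `γ`.
  have hsub : Icc (0 : ℝ) 1 ⊆ {t | ∃ q, f q = γ t ∧ g.edist x q ≤ Φ t} := by
    refine IsClosed.Icc_subset_of_forall_exists_gt (IsClosed.inter ?_ isClosed_Icc) ?_ ?_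
    -- Compactness of `M` makes the projection `M × ℝ → ℝ` closed, so limits of reachable times are
    -- reachable.
    · have hcl : IsClosed {p : M × ℝ | f p.1 = γ p.2 ∧ g.edist x p.1 ≤ Φ p.2} :=
        (isClosed_eq (h.contMDiff.continuous.comp continuous_fst)
          (hγ.continuous.comp continuous_snd)).inter
          (isClosed_le ((g.continuous_edist x).comp continuous_fst) (hΦ.comp continuous_snd))
      convert isClosedMap_snd_of_compactSpace _ hcl using 1
      ext t
      simp
    · exact ⟨x, h0.symm, by simp [g.edist_self]⟩
    · rintro t ⟨⟨q, hq, hxq⟩, ht⟩ y hy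
      -- The lift need only be horizontal at time `t`: the speeds then agree there, and continuity
      -- keeps the upper one below `b.speed γ + ε` shortly afterwards.
      obtain ⟨u, hu, hdu⟩ := h.exists_isHorizontal_lift q
        (mfderiv 𝓘(ℝ, ℝ) 𝓘(ℝ, F) γ t (1 : ℝ) : F)
      obtain ⟨c, hc0, hc, hfc, hcu⟩ :=
        (h.submersion.isSubmersionOfComplement_complement q).exists_curve_lift (γ := γ)
          hγ.contMDiffAt hq u hdu
      subst hc0
      obtain ⟨U, hU, hcU⟩ := (contMDiffAt_iff_contMDiffOn_nhds (by simp)).1 hc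
      have hct : g.speed c t = b.speed γ t := by
        have h1 := h.isometry (c t) u u hu hu
        have h2 : ∀ {y y' : N} (_ : y = y') {v w : F} (_ : v = w),
            b.inner y v v = b.inner y' w w := by
          rintro y _ rfl v _ rfl
          rfl
        rw [RiemMetric.speed, RiemMetric.speed]
        refine congrArg Real.sqrt (Eq.trans ?_ (h1.symm.trans (h2 hq hdu)))
        exact congrArg (fun w : E ↦ g.inner (c t) w w) hcu
      have hcs : ContinuousAt (g.speed c) t :=
        (g.continuousOn_speed isOpen_interior (hcU.mono interior_subset)).continuousAt
          (isOpen_interior.mem_nhds (mem_interior_iff_mem_nhds.2 hU))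
      have hev : ∀ᶠ s in 𝓝 t, (f (c s) = γ s ∧ s ∈ U) ∧ g.speed c s < b.speed γ s + ε :=
        (hfc.and hU).and (hcs.eventually_lt hvc.continuousAt (by linarith))
      obtain ⟨δ, hδ, hball⟩ := Metric.eventually_nhds_iff.1 hev
      have hlt : t < min y (t + δ / 2) := lt_min hy (by linarith)
      refine ⟨min y (t + δ / 2), ⟨c (min y (t + δ / 2)), ?_, ?_⟩, hlt, min_le_left _ _⟩
      all_goals
        set s := min y (t + δ / 2)
        have hs : ∀ τ ∈ Icc t s, dist τ t < δ := by
          intro τ hτ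
          have : s ≤ t + δ / 2 := min_le_right _ _
          rw [Real.dist_eq, abs_of_nonneg (by linarith [hτ.1])]
          linarith [hτ.2]
      · exact (hball (hs s (right_mem_Icc.2 hlt.le))).1.1
      · rw [hΦadd t s ht.1 hlt.le]
        refine (g.edist_triangle x (c t) (c s)).trans (add_le_add hxq ?_)
        refine (g.edist_le_lintegral_speed hlt.le
          (hcU.mono fun τ hτ ↦ (hball (hs τ hτ)).1.2)).trans ?_
        exact setLIntegral_mono' measurableSet_Icc fun τ hτ ↦
          ENNReal.ofReal_le_ofReal (hball (hs τ hτ)).2.le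
  obtain ⟨q, hq, hxq⟩ := hsub (right_mem_Icc.2 zero_le_one)
  refine ⟨q, hq, hxq.trans ?_⟩
  have hsum : ∀ τ, ENNReal.ofReal (b.speed γ τ + ε) =
      ENNReal.ofReal (b.speed γ τ) + ENNReal.ofReal ε :=
    fun τ ↦ ENNReal.ofReal_add (Real.sqrt_nonneg _) hε.le
  rw [hΦadd 0 1 le_rfl zero_le_one]
  simp only [hsum]
  rw [lintegral_add_right _ measurable_const]
  simpa [Φ] using hlε.le

end RiemannianSubmersion

/-! ### Invariant metrics and their pointwise limits -/

section Invariance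

variable {E : Type*} [NormedAddCommGroup E] [NormedSpace ℝ E]
  {M : Type*} [TopologicalSpace M] [ChartedSpace E M]
  {F : Type*} [NormedAddCommGroup F] [NormedSpace ℝ F]
  {N : Type*} [TopologicalSpace N] [ChartedSpace F N]
  {G : Type*} [Group G] [MulAction G M] [MulAction G N]

lemma mfderiv_smul_bijective (hM : ∀ a : G, MDifferentiable 𝓘(ℝ, E) 𝓘(ℝ, E) (fun x : M ↦ a • x))
    (a : G) (x : M) :
    Function.Bijective (mfderiv 𝓘(ℝ, E) 𝓘(ℝ, E) (fun y : M ↦ a • y) x) := by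
  have key : ∀ (a : G) (x : M) (v : TangentSpace 𝓘(ℝ, E) x),
      (mfderiv 𝓘(ℝ, E) 𝓘(ℝ, E) (fun y : M ↦ a⁻¹ • y) (a • x)
        (mfderiv 𝓘(ℝ, E) 𝓘(ℝ, E) (fun y : M ↦ a • y) x v) : E) = v := by
    intro a x v
    have h1 := mfderiv_comp x (hM a⁻¹ (a • x)) (hM a x)
    have h2 : (fun y : M ↦ a⁻¹ • y) ∘ (fun y : M ↦ a • y) = id := by
      ext y
      simp
    rw [h2, mfderiv_id] at h1
    exact (DFunLike.congr_fun h1 v).symm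
  refine ⟨fun v w hvw ↦ ?_, fun v ↦ ?_⟩
  · have h := congrArg (mfderiv 𝓘(ℝ, E) 𝓘(ℝ, E) (fun y : M ↦ a⁻¹ • y) (a • x)) hvw
    exact (key a x v).symm.trans (Eq.trans h (key a x w))
  · have h := key a⁻¹ (a • x) v
    rw [inv_inv, inv_smul_smul] at h
    exact ⟨_, h⟩

variable [IsManifold 𝓘(ℝ, E) ∞ M] [IsManifold 𝓘(ℝ, F) ∞ N]

lemma RiemMetric.inner_congr (g : RiemMetric E M) {x y : M} (h : x = y) {v v' w w' : E}
    (hv : v = v') (hw : w = w') : g.inner x v w = g.inner y v' w' := by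
  subst h hv hw
  rfl

lemma RiemMetric.IsInvariant.edist_smul {g : RiemMetric E M} (hg : g.IsInvariant G)
    (hM : ∀ a : G, ContMDiff 𝓘(ℝ, E) 𝓘(ℝ, E) ∞ (fun x : M ↦ a • x)) (a : G) (x y : M) :
    g.edist (a • x) (a • y) = g.edist x y := by
  have key : ∀ (a : G) (x y : M), g.edist (a • x) (a • y) ≤ g.edist x y := fun a x y ↦ by
    simpa using RiemMetric.edist_map_le g g ((hM a).of_le (by simp)) one_pos
      (fun x v ↦ by simpa using (hg a x v v).le) x y
  refine le_antisymm (key a x y) ?_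
  simpa using key a⁻¹ (a • x) (a • y)

/-- Equivariance makes the action preserve vertical vectors, hence also horizontal ones since it is
isometric upstairs; the base metric is read off from horizontal lifts. -/
lemma IsRiemannianSubmersion.isInvariant [FiniteDimensional ℝ E]
    (hM : ∀ a : G, MDifferentiable 𝓘(ℝ, E) 𝓘(ℝ, E) (fun x : M ↦ a • x))
    (hN : ∀ a : G, MDifferentiable 𝓘(ℝ, F) 𝓘(ℝ, F) (fun x : N ↦ a • x))
    {g : RiemMetric E M} {b : RiemMetric F N} {f : M → N} (h : IsRiemannianSubmersion g b f)
    (hg : g.IsInvariant G) (hs : Function.Surjective f) (hf : ∀ (a : G) x, f (a • x) = a • f x) :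
    b.IsInvariant G := by
  intro a y v w
  obtain ⟨x, rfl⟩ := hs y
  have hfd : MDifferentiable 𝓘(ℝ, E) 𝓘(ℝ, F) f := h.contMDiff.mdifferentiable (by simp)
  have hcomm : ∀ u : TangentSpace 𝓘(ℝ, E) x,
      (mfderiv 𝓘(ℝ, E) 𝓘(ℝ, F) f (a • x)
        (mfderiv 𝓘(ℝ, E) 𝓘(ℝ, E) (fun z : M ↦ a • z) x u) : F) =
      mfderiv 𝓘(ℝ, F) 𝓘(ℝ, F) (fun z : N ↦ a • z) (f x) (mfderiv 𝓘(ℝ, E) 𝓘(ℝ, F) f x u) := by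
    intro u
    have h1 := mfderiv_comp x (hfd (a • x)) (hM a x)
    have h2 := mfderiv_comp x (hN a (f x)) (hfd x)
    have h3 : f ∘ (fun z : M ↦ a • z) = (fun z : N ↦ a • z) ∘ f := by
      ext z
      exact hf a z
    rw [h3] at h1
    exact (DFunLike.congr_fun h1 u).symm.trans (DFunLike.congr_fun h2 u)
  have hhor : ∀ u : TangentSpace 𝓘(ℝ, E) x, g.IsHorizontal (F := F) f x u →
      g.IsHorizontal (F := F) f (a • x)
        (mfderiv 𝓘(ℝ, E) 𝓘(ℝ, E) (fun z : M ↦ a • z) x u) := by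
    intro u hu u' hu'
    obtain ⟨u'', rfl⟩ := (mfderiv_smul_bijective hM a x).2 u'
    refine (hg a x u'' u).trans (hu u'' ?_)
    refine (mfderiv_smul_bijective hN a (f x)).1 ?_
    exact ((hcomm u'').symm.trans hu').trans (map_zero _).symm
  obtain ⟨v, hv, rfl⟩ := h.exists_isHorizontal_lift x v
  obtain ⟨w, hw, rfl⟩ := h.exists_isHorizontal_lift x w
  calc _ = _ := b.inner_congr (hf a x).symm (hcomm v).symm (hcomm w).symm
    _ = _ := h.isometry (a • x) _ _ (hhor v hv) (hhor w hw)
    _ = g.inner x v w := hg a x v w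
    _ = _ := (h.isometry x v w hv hw).symm

lemma RiemMetric.IsInvariant.of_tendsto {ι : Type*} {l : Filter ι} [l.NeBot]
    {b : ι → RiemMetric F N} {b' : RiemMetric F N} (hb : ∀ i, (b i).IsInvariant G)
    (h : ∀ (y : N) (v w : TangentSpace 𝓘(ℝ, F) y),
      Tendsto (fun i ↦ (b i).inner y v w) l (𝓝 (b'.inner y v w))) : b'.IsInvariant G := by
  intro a x v w
  refine tendsto_nhds_unique (h _ _ _) ?_
  simpa only [hb _ a x v w] using h x v w

/-- On a finite-dimensional space, bilinear forms that converge pointwise to an inner product do so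
uniformly on the unit sphere. -/
lemma eventually_abs_sub_norm_sq_le {V : Type*} [NormedAddCommGroup V] [InnerProductSpace ℝ V]
    [FiniteDimensional ℝ V] {ι : Type*} {l : Filter ι} {B : ι → V →ₗ[ℝ] V →ₗ[ℝ] ℝ}
    (hB : ∀ v w, Tendsto (fun i ↦ B i v w) l (𝓝 (inner ℝ v w))) {δ : ℝ} (hδ : 0 < δ) :
    ∀ᶠ i in l, ∀ v, |B i v v - inner ℝ v v| ≤ δ * inner ℝ v v := by
  let e := stdOrthonormalBasis ℝ V
  have hsum : Tendsto (fun i ↦ ∑ j, ∑ k, |B i (e j) (e k) - inner ℝ (e j) (e k)|) l (𝓝 0) := by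
    have : Tendsto (fun i ↦ ∑ j, ∑ k, |B i (e j) (e k) - inner ℝ (e j) (e k)|) l
        (𝓝 (∑ j, ∑ k, |inner ℝ (e j) (e k) - inner ℝ (e j) (e k)|)) :=
      tendsto_finsetSum _ fun j _ ↦ tendsto_finsetSum _ fun k _ ↦
        ((hB (e j) (e k)).sub_const _).abs
    simpa using this
  filter_upwards [hsum.eventually_lt_const hδ] with i hi v
  let D : V →ₗ[ℝ] V →ₗ[ℝ] ℝ := B i - innerₗ V
  -- Expansion in an orthonormal basis, where each coordinate of `v` is at most `‖v‖`.
  have hD : B i v v - inner ℝ v v = ∑ j, ∑ k, e.repr v j * (e.repr v k * D (e j) (e k)) := by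
    change D v v = _
    conv_lhs => rw [← e.sum_repr v]
    simp only [map_sum, LinearMap.sum_apply, map_smul, LinearMap.smul_apply, smul_eq_mul]
    rw [Finset.sum_comm]
    refine Finset.sum_congr rfl fun j _ ↦ ?_
    rw [Finset.mul_sum]
    exact Finset.sum_congr rfl fun k _ ↦ by ring
  have hc : ∀ j, |e.repr v j| ≤ ‖v‖ := fun j ↦ by
    rw [e.repr_apply_apply]
    simpa using abs_real_inner_le_norm (e j) v
  rw [hD]
  calc |∑ j, ∑ k, e.repr v j * (e.repr v k * D (e j) (e k))|
      ≤ ∑ j, ∑ k, |e.repr v j * (e.repr v k * D (e j) (e k))| :=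
        (Finset.abs_sum_le_sum_abs _ _).trans
          (Finset.sum_le_sum fun j _ ↦ Finset.abs_sum_le_sum_abs _ _)
    _ ≤ ∑ j, ∑ k, ‖v‖ * (‖v‖ * |D (e j) (e k)|) := by
        refine Finset.sum_le_sum fun j _ ↦ Finset.sum_le_sum fun k _ ↦ ?_
        rw [abs_mul, abs_mul]
        gcongr <;> exact hc _
    _ = (∑ j, ∑ k, |B i (e j) (e k) - inner ℝ (e j) (e k)|) * inner ℝ v v := by
        rw [real_inner_self_eq_norm_sq, Finset.sum_mul]
        refine Finset.sum_congr rfl fun j _ ↦ ?_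
        rw [Finset.sum_mul]
        refine Finset.sum_congr rfl fun k _ ↦ ?_
        change _ * (_ * |B i (e j) (e k) - inner ℝ (e j) (e k)|) = _
        ring
    _ ≤ δ * inner ℝ v v := by
        gcongr
        exact real_inner_self_nonneg

/-- Both metrics are invariant and the action is transitive, so a comparison at `y₀` holds
everywhere with the same constant. -/
lemma RiemMetric.eventually_inner_le [FiniteDimensional ℝ F] [MulAction.IsPretransitive G N]
    (hN : ∀ a : G, MDifferentiable 𝓘(ℝ, F) 𝓘(ℝ, F) (fun x : N ↦ a • x))
    {ι : Type*} {l : Filter ι} {b : ι → RiemMetric F N} {b' : RiemMetric F N}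
    (hb : ∀ i, (b i).IsInvariant G) (hb' : b'.IsInvariant G) (y₀ : N)
    (h : ∀ v w : TangentSpace 𝓘(ℝ, F) y₀,
      Tendsto (fun i ↦ (b i).inner y₀ v w) l (𝓝 (b'.inner y₀ v w))) {η : ℝ} (hη : 0 < η) :
    ∀ᶠ i in l, ∀ (y : N) (v : TangentSpace 𝓘(ℝ, F) y),
      (b i).inner y v v ≤ (1 + η) ^ 2 * b'.inner y v v ∧
      b'.inner y v v ≤ (1 + η) ^ 2 * (b i).inner y v v := by
  have h0 : ∀ᶠ i in l, ∀ v : TangentSpace 𝓘(ℝ, F) y₀,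
      -- Since `1 - η / (1 + η) = 1 / (1 + η)`, this error bounds both ratios of the squared norms
      -- by `1 + η`.
      |(b i).inner y₀ v v - b'.inner y₀ v v| ≤ η / (1 + η) * b'.inner y₀ v v := by
    let : RiemannianBundle (fun x : N ↦ TangentSpace 𝓘(ℝ, F) x) := ⟨b'.toRiemannianMetric⟩
    have : FiniteDimensional ℝ (TangentSpace 𝓘(ℝ, F) y₀) :=
      inferInstanceAs (FiniteDimensional ℝ F)
    exact eventually_abs_sub_norm_sq_le (V := TangentSpace 𝓘(ℝ, F) y₀)
      (B := fun i ↦ LinearMap.mk₂ ℝ (fun v w ↦ (b i).inner y₀ v w) (by simp) (by simp) (by simp)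
        (by simp)) h (by positivity)
  filter_upwards [h0] with i hi y v
  obtain ⟨a, rfl⟩ := MulAction.exists_smul_eq G y₀ y
  obtain ⟨v, rfl⟩ := (mfderiv_smul_bijective hN a y₀).2 v
  rw [hb i a, hb' a]
  obtain ⟨h1, h2⟩ := abs_le.1 (hi v)
  have h3 := b'.inner_self_nonneg y₀ v
  have h4 : η / (1 + η) ≤ η := div_le_self hη.le (by linarith)
  have h5 : (1 + η) ^ 2 * (1 - η / (1 + η)) = 1 + η := by field_simp; ring
  constructor
  · nlinarith [mul_le_mul_of_nonneg_right h4 h3]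
  · have h6 : (1 - η / (1 + η)) * b'.inner y₀ v v ≤ (b i).inner y₀ v v := by linarith
    have h7 := mul_le_mul_of_nonneg_left h6 (sq_nonneg (1 + η))
    rw [← mul_assoc, h5] at h7
    nlinarith

end Invariance

/-! ### Gromov–Hausdorff estimates -/

section GromovHausdorff

lemma gromovHausdorffDist_le_of_surjective {A B : Type*} {dA : A → A → ℝ} {dB : B → B → ℝ}
    {f : A → B} (hf : Function.Surjective f) {ε : ℝ}
    (h : ∀ p q, |dA p q - dB (f p) (f q)| < ε) :
    gromovHausdorffDist dA dB ≤ ENNReal.ofReal ε := by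
  refine iInf₂_le ε ⟨{p | f p.1 = p.2}, fun a ↦ ⟨f a, rfl⟩, fun b ↦ hf b, ?_⟩
  intro p hp q hq
  rw [← show f p.1 = p.2 from hp, ← show f q.1 = q.2 from hq]
  exact h p.1 q.1

/-- All distances in the one-point space vanish, so the distortion of an approximation bounds the
distances in `A` themselves. -/
lemma lt_of_gromovHausdorffDist_unit_lt {A : Type*} {d : A → A → ℝ} {ε : ℝ}
    (h : gromovHausdorffDist d (fun _ _ : Unit ↦ (0 : ℝ)) < ENNReal.ofReal ε) (x y : A) :
    d x y < ε := by
  obtain ⟨ε', ⟨S, hS⟩, hε⟩ := by simpa only [gromovHausdorffDist, iInf_lt_iff] using h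
  obtain ⟨_, hx⟩ := hS.fst_onto x
  obtain ⟨_, hy⟩ := hS.fst_onto y
  have h1 := hS.dist_lt _ hx _ hy
  have h2 := (ENNReal.ofReal_lt_ofReal_iff_of_nonneg
    ((abs_nonneg _).trans h1.le)).1 hε
  simp only [sub_zero] at h1
  exact (le_abs_self _).trans_lt (h1.trans h2)

lemma tendsto_gromovHausdorffDist_zero {A B ι : Type*} {l : Filter ι} {dA : ι → A → A → ℝ}
    {dB : ι → B → B → ℝ} {f : A → B} (hf : Function.Surjective f)
    (h : ∀ ε > 0, ∀ᶠ i in l, ∀ p q, |dA i p q - dB i (f p) (f q)| ≤ ε) :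
    Tendsto (fun i ↦ gromovHausdorffDist (dA i) (dB i)) l (𝓝 0) := by
  refine ENNReal.tendsto_nhds_zero.2 fun ε hε ↦ ?_
  obtain ⟨δ, hδ, hδε⟩ : ∃ δ : ℝ, 0 < δ ∧ ENNReal.ofReal δ < ε := by
    obtain ⟨δ, hδ, hδε⟩ := ENNReal.lt_iff_exists_nnreal_btwn.1 hε
    exact ⟨δ, by simpa using hδ, by simpa using hδε⟩
  filter_upwards [h (δ / 2) (by positivity)] with i hi
  exact (gromovHausdorffDist_le_of_surjective hf fun p q ↦
    (hi p q).trans_lt (half_lt_self hδ)).trans hδε.le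

end GromovHausdorff

/-! ### Fibres of the projection between homogeneous spaces -/

section Homogeneous

lemma cosetProj_surjective {G : Type*} [Group G] {K H : Subgroup G} (hKH : K ≤ H) : Function.Surjective (cosetProj hKH) := by
  intro y
  obtain ⟨a, rfl⟩ := QuotientGroup.mk_surjective y
  exact ⟨(a : G ⧸ K), rfl⟩

lemma cosetProj_smul {G : Type*} [Group G] {K H : Subgroup G} (hKH : K ≤ H) (a : G) (x : G ⧸ K) :
    cosetProj hKH (a • x) = a • cosetProj hKH x := by
  obtain ⟨c, rfl⟩ := QuotientGroup.mk_surjective x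
  rfl

variable {E : Type*} [NormedAddCommGroup E] [NormedSpace ℝ E]
  {G : Type*} [TopologicalSpace G] [ChartedSpace E G] [Group G] [LieGroup 𝓘(ℝ, E) ∞ G]
  {K H : Subgroup G}
  {EK : Type*} [NormedAddCommGroup EK] [NormedSpace ℝ EK] [ChartedSpace EK (G ⧸ K)]
  {EH : Type*} [NormedAddCommGroup EH] [NormedSpace ℝ EH] [ChartedSpace EH (G ⧸ H)]

/-- A Lie group acts smoothly on its homogeneous spaces. -/
lemma IsHomogeneousManifold.contMDiff_smul (hGK : IsHomogeneousManifold (E := E) K EK) (a : G) :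
    ContMDiff 𝓘(ℝ, EK) 𝓘(ℝ, EK) ∞ (fun x : G ⧸ K ↦ a • x) := by
  have hGK' : Manifold.IsSubmersion 𝓘(ℝ, E) 𝓘(ℝ, EK) ∞ (QuotientGroup.mk : G → G ⧸ K) := hGK
  refine hGK'.contMDiff_of_comp Quotient.mk_surjective ?_
  exact hGK'.contMDiff.comp (contMDiff_mul_left (I := 𝓘(ℝ, E)) (n := ∞) (a := a))

variable [IsManifold 𝓘(ℝ, EK) ∞ (G ⧸ K)] [IsManifold 𝓘(ℝ, EH) ∞ (G ⧸ H)]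

/-- For an invariant metric, all fibres of `G ⧸ K → G ⧸ H` have the diameter of the fibre over the
base point. -/
lemma edist_le_of_cosetProj_eq [ConnectedSpace (G ⧸ K)] (hKH : K ≤ H)
    (hGK : IsHomogeneousManifold (E := E) K EK)
    {g : RiemMetric EK (G ⧸ K)} (hg : g.IsInvariant G) {δ : ℝ}
    (hδ : ∀ x y : cosetFibre hKH, g.rdist (x : G ⧸ K) y < δ) {p q : G ⧸ K}
    (hpq : cosetProj hKH p = cosetProj hKH q) : g.edist p q ≤ ENNReal.ofReal δ := by
  obtain ⟨a, rfl⟩ := QuotientGroup.mk_surjective p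
  have hp : a⁻¹ • (a : G ⧸ K) ∈ cosetFibre hKH := by
    change cosetProj hKH _ = _
    rw [cosetProj_smul]
    change ((a⁻¹ * a : G) : G ⧸ H) = _
    rw [inv_mul_cancel]
  have hq : a⁻¹ • q ∈ cosetFibre hKH := by
    change cosetProj hKH _ = _
    rw [cosetProj_smul, ← hpq, ← cosetProj_smul]
    exact hp
  rw [← hg.edist_smul hGK.contMDiff_smul a⁻¹,
    ENNReal.le_ofReal_iff_toReal_le (g.edist_ne_top _ _)]
  · exact (hδ ⟨_, hp⟩ ⟨_, hq⟩).le
  · exact ENNReal.toReal_nonneg.trans (hδ ⟨_, hp⟩ ⟨_, hq⟩).le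

/-- The projection of an invariant submersion metric changes distances at most by the diameter of
the fibre. -/
lemma abs_rdist_sub_rdist_cosetProj_le [FiniteDimensional ℝ EK] [CompactSpace (G ⧸ K)]
    [ConnectedSpace (G ⧸ K)] [T2Space (G ⧸ H)] (hKH : K ≤ H)
    (hGK : IsHomogeneousManifold (E := E) K EK)
    {g : RiemMetric EK (G ⧸ K)} (hg : g.IsInvariant G) {b : RiemMetric EH (G ⧸ H)}
    (hb : IsRiemannianSubmersion g b (cosetProj hKH)) {δ : ℝ} (hδ0 : 0 ≤ δ)
    (hδ : ∀ x y : cosetFibre hKH, g.rdist (x : G ⧸ K) y < δ) (p q : G ⧸ K) :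
    |g.rdist p q - b.rdist (cosetProj hKH p) (cosetProj hKH q)| ≤ δ := by
  have h1 := hb.edist_le p q
  have htop := ne_top_of_le_ne_top (g.edist_ne_top p q) h1
  have h2 : g.edist p q ≤ b.edist (cosetProj hKH p) (cosetProj hKH q) + ENNReal.ofReal δ := by
    rw [← tsub_le_iff_right]
    -- Every `r` above the base distance suffices to reach some `q'` in the fibre of `q`; going on
    -- from `q'` to `q` costs at most `δ`.
    refine le_of_forall_gt_imp_ge_of_dense fun r hr ↦ ?_
    obtain ⟨q', hq', hpq'⟩ := hb.exists_edist_le hr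
    rw [tsub_le_iff_right]
    exact (g.edist_triangle p q' q).trans
      (add_le_add hpq' (edist_le_of_cosetProj_eq hKH hGK hg hδ hq'))
  have h3 := ENNReal.toReal_mono (ENNReal.add_ne_top.2 ⟨htop, ENNReal.ofReal_ne_top⟩) h2
  rw [ENNReal.toReal_add htop ENNReal.ofReal_ne_top, ENNReal.toReal_ofReal hδ0] at h3
  have h4 := ENNReal.toReal_mono (g.edist_ne_top p q) h1
  rw [RiemMetric.rdist_eq_toReal_edist, RiemMetric.rdist_eq_toReal_edist, abs_le]
  constructor <;> linarith

end Homogeneous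

/-! ### Uniform convergence of invariant distances -/

section Comparison

variable {F : Type*} [NormedAddCommGroup F] [NormedSpace ℝ F]
  {N : Type*} [TopologicalSpace N] [ChartedSpace F N] [IsManifold 𝓘(ℝ, F) ∞ N]

namespace RiemMetric

lemma rdist_le_mul_of_inner_le [PreconnectedSpace N] (b b' : RiemMetric F N) {C : ℝ} (hC : 0 < C)
    (h : ∀ (y : N) (v : TangentSpace 𝓘(ℝ, F) y), b.inner y v v ≤ C ^ 2 * b'.inner y v v)
    (x y : N) : b.rdist x y ≤ C * b'.rdist x y := by
  have h1 := edist_map_le b' b contMDiff_id hC (fun y v ↦ by simpa using h y v) x y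
  have h2 := ENNReal.toReal_mono (ENNReal.mul_ne_top ENNReal.ofReal_ne_top (b'.edist_ne_top x y)) h1
  rwa [ENNReal.toReal_mul, ENNReal.toReal_ofReal hC.le] at h2

lemma exists_rdist_le [CompactSpace N] [ConnectedSpace N] (b : RiemMetric F N) :
    ∃ D, 0 ≤ D ∧ ∀ x y, b.rdist x y ≤ D := by
  obtain ⟨x₀⟩ : Nonempty N := inferInstance
  have hc : Continuous (b.rdist x₀) :=
    continuous_iff_continuousAt.2 fun y ↦
      (ENNReal.tendsto_toReal (b.edist_ne_top x₀ y)).comp (b.continuous_edist x₀).continuousAt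
  obtain ⟨D, hD⟩ := (isCompact_range hc).bddAbove
  have hD' : ∀ x, b.rdist x₀ x ≤ D := fun x ↦ hD ⟨x, rfl⟩
  have hD0 : 0 ≤ D := ENNReal.toReal_nonneg.trans (hD' x₀)
  refine ⟨D + D, by positivity, fun x y ↦ ?_⟩
  have h1 := ENNReal.toReal_mono (ENNReal.add_ne_top.2 ⟨b.edist_ne_top x x₀, b.edist_ne_top x₀ y⟩)
    (b.edist_triangle x x₀ y)
  rw [ENNReal.toReal_add (b.edist_ne_top x x₀) (b.edist_ne_top x₀ y), b.edist_comm x x₀] at h1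
  exact h1.trans (add_le_add (hD' x) (hD' y))

/-- Invariant metrics that converge pointwise converge uniformly as distance functions. -/
lemma eventually_abs_rdist_sub_le {G : Type*} [Group G] [MulAction G N]
    [MulAction.IsPretransitive G N] [FiniteDimensional ℝ F] [CompactSpace N] [ConnectedSpace N]
    (hN : ∀ a : G, MDifferentiable 𝓘(ℝ, F) 𝓘(ℝ, F) (fun x : N ↦ a • x))
    {ι : Type*} {l : Filter ι} {b : ι → RiemMetric F N} {b' : RiemMetric F N}
    (hb : ∀ i, (b i).IsInvariant G)
    (h : ∀ (y : N) (v w : TangentSpace 𝓘(ℝ, F) y),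
      Tendsto (fun i ↦ (b i).inner y v w) l (𝓝 (b'.inner y v w))) {ε : ℝ} (hε : 0 < ε) :
    ∀ᶠ i in l, ∀ x y, |(b i).rdist x y - b'.rdist x y| ≤ ε := by
  -- Invariance of `b'` rests on uniqueness of limits, which needs a nontrivial filter.
  rcases l.eq_or_neBot with rfl | hl
  · simp
  obtain ⟨D, hD0, hD⟩ := b'.exists_rdist_le
  obtain ⟨y₀⟩ : Nonempty N := inferInstance
  -- With `η ≤ 1` the `b i`-distances are at most `2 * D`, so a relative error `η` costs at most `η
  -- * (2 * D)`.
  obtain ⟨η, hη, hη1, hηD⟩ : ∃ η : ℝ, 0 < η ∧ η ≤ 1 ∧ η * (2 * D) ≤ ε := by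
    refine ⟨min 1 (ε / (2 * D + 1)), by positivity, min_le_left _ _, ?_⟩
    calc min 1 (ε / (2 * D + 1)) * (2 * D) ≤ ε / (2 * D + 1) * (2 * D + 1) := by
          gcongr
          · exact min_le_right _ _
          · linarith
      _ = ε := by field_simp
  filter_upwards [eventually_inner_le hN hb (IsInvariant.of_tendsto hb h) y₀ (h y₀) hη]
    with i hi x y
  have h1 := rdist_le_mul_of_inner_le (b i) b' (by positivity) (fun y v ↦ (hi y v).1) x y
  have h2 := rdist_le_mul_of_inner_le b' (b i) (by positivity) (fun y v ↦ (hi y v).2) x y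
  have h3 : 0 ≤ b'.rdist x y := ENNReal.toReal_nonneg
  have h4 : η * b'.rdist x y ≤ η * D := mul_le_mul_of_nonneg_left (hD x y) hη.le
  have h5 : η * (b i).rdist x y ≤ η * (2 * D) := by
    refine mul_le_mul_of_nonneg_left ?_ hη.le
    nlinarith [hD x y]
  rw [abs_le]
  constructor <;> nlinarith

end RiemMetric

end Comparison

theorem mainTheorem11
    -- a Lie group `G` and closed subgroups `K ≤ H`
    {E : Type*} [NormedAddCommGroup E] [NormedSpace ℝ E] [FiniteDimensional ℝ E]
    {G : Type*} [TopologicalSpace G] [T2Space G] [SecondCountableTopology G]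
    [ChartedSpace E G] [Group G] [LieGroup 𝓘(ℝ, E) ∞ G]
    (K H : Subgroup G) (hK : IsClosed (K : Set G)) (hH : IsClosed (H : Set G)) (hKH : K ≤ H)
    -- the homogeneous spaces `G ⧸ K` and `G ⧸ H` with their smooth structures
    {EK : Type*} [NormedAddCommGroup EK] [NormedSpace ℝ EK] [FiniteDimensional ℝ EK]
    [ChartedSpace EK (G ⧸ K)] [IsManifold 𝓘(ℝ, EK) ∞ (G ⧸ K)]
    (hGK : IsHomogeneousManifold (E := E) K EK)
    {EH : Type*} [NormedAddCommGroup EH] [NormedSpace ℝ EH] [FiniteDimensional ℝ EH]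
    [ChartedSpace EH (G ⧸ H)] [IsManifold 𝓘(ℝ, EH) ∞ (G ⧸ H)]
    (hGH : IsHomogeneousManifold (E := E) H EH)
    [CompactSpace (G ⧸ K)] [ConnectedSpace (G ⧸ K)]
    -- every invariant metric on `G ⧸ K` is a submersion metric
    (hsub : ∀ g : RiemMetric EK (G ⧸ K), g.IsInvariant G →
      ∃ b : RiemMetric EH (G ⧸ H), IsRiemannianSubmersion g b (cosetProj hKH))
    -- a family of invariant metrics for which the fibre `H/K` shrinks to a point
    {ι : Type*} (l : Filter ι) (g : ι → RiemMetric EK (G ⧸ K))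
    (hg : ∀ i, (g i).IsInvariant G)
    (hshrink : Tendsto (fun i ↦ gromovHausdorffDist
      (fun x y : cosetFibre hKH ↦ (g i).rdist (x : G ⧸ K) (y : G ⧸ K))
      (fun _ _ : Unit ↦ (0 : ℝ))) l (𝓝 0)) :
    -- the induced base metrics
    ∃ b : ι → RiemMetric EH (G ⧸ H),
      (∀ i, (b i).IsInvariant G ∧ IsRiemannianSubmersion (g i) (b i) (cosetProj hKH)) ∧
      Tendsto (fun i ↦ gromovHausdorffDist (g i).rdist (b i).rdist) l (𝓝 0) ∧
      ∀ b' : RiemMetric EH (G ⧸ H),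
        (∀ (y : G ⧸ H) (v w : TangentSpace 𝓘(ℝ, EH) y),
          Tendsto (fun i ↦ (b i).inner y v w) l (𝓝 (b'.inner y v w))) →
        Tendsto (fun i ↦ gromovHausdorffDist (g i).rdist b'.rdist) l (𝓝 0) := by
  -- Together with `hH` this makes `G ⧸ H` Hausdorff, as the lifting of curves requires.
  have : IsTopologicalGroup G := topologicalGroup_of_lieGroup 𝓘(ℝ, E) ∞
  have hMK := fun a ↦ (hGK.contMDiff_smul a).mdifferentiable (by simp)
  have hMH := fun a ↦ (hGH.contMDiff_smul a).mdifferentiable (by simp)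
  have hsurj := cosetProj_surjective hKH
  choose b hb using fun i ↦ hsub (g i) (hg i)
  have hbinv : ∀ i, (b i).IsInvariant G := fun i ↦
    (hb i).isInvariant hMK hMH (hg i) hsurj (cosetProj_smul hKH)
  have hclose : ∀ ε > 0, ∀ᶠ i in l, ∀ p q,
      |(g i).rdist p q - (b i).rdist (cosetProj hKH p) (cosetProj hKH q)| ≤ ε := by
    intro ε hε
    filter_upwards [hshrink.eventually_lt_const (ENNReal.ofReal_pos.2 hε)] with i hi
    exact abs_rdist_sub_rdist_cosetProj_le hKH hGK (hg i) (hb i) hε.le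
      (lt_of_gromovHausdorffDist_unit_lt hi)
  refine ⟨b, fun i ↦ ⟨hbinv i, hb i⟩, tendsto_gromovHausdorffDist_zero hsurj hclose,
    fun b' hb' ↦ tendsto_gromovHausdorffDist_zero hsurj fun ε hε ↦ ?_⟩
  -- Continuity of the projection is read off from one of the submersions, so an index is needed.
  rcases isEmpty_or_nonempty ι with hι | ⟨⟨i₀⟩⟩
  · exact .of_forall fun i ↦ hι.elim i
  have hcont : Continuous (cosetProj hKH) := (hb i₀).contMDiff.continuous
  have : CompactSpace (G ⧸ H) := hsurj.compactSpace hcont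
  have : ConnectedSpace (G ⧸ H) := hsurj.connectedSpace hcont
  filter_upwards [hclose (ε / 2) (half_pos hε),
    RiemMetric.eventually_abs_rdist_sub_le hMH hbinv hb' (half_pos hε)] with i h1 h2 p q
  have h3 := abs_add_le ((g i).rdist p q - (b i).rdist (cosetProj hKH p) (cosetProj hKH q))
    ((b i).rdist (cosetProj hKH p) (cosetProj hKH q) - b'.rdist (cosetProj hKH p) (cosetProj hKH q))
  rw [sub_add_sub_cancel] at h3
  linarith [h1 p q, h2 (cosetProj hKH p) (cosetProj hKH q)]
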